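/- Let $m,\varsigma\ge 1$ be integers, let $\mathcal R=\mathbb F_{2^m}+u\mathbb F_{2^m}+u^2\mathbb F_{2^m}$ with $u^3=0$, and let $\mathcal S=\mathcal R[x]/\langle x^{2^\varsigma}-1\rangle$, whose ideals are the cyclic codes of length $2^\varsigma$ over $\mathcal R$; a codeword is identified with its representative $a_0+a_1x+\cdots+a_{2^\varsigma-1}x^{2^\varsigma-1}$, $a_i\in\mathcal R$. Let $\mathcal B=\{\zeta_1,\dots,\zeta_m\}$ be any trace orthogonal basis of $\mathbb F_{2^m}$ over $\mathbb F_2$, i.e. a basis with $\mathrm{Tr}(\zeta_i\zeta_j)=1$ if $i=j$ and $0$ if $i\ne j$. The Lee weight $wt(a)$ of $a=\sum_i a_i\zeta_i\in\mathbb F_{2^m}$ ($a_i\in\mathbb F_2$) is the number of $i$ with $a_i\neq 0$; the Lee weight of $a+ub+u^2c\in\mathcal R$ ($a,b,c\in\mathbb F_{2^m}$) is $wt(a+b+c)+wt(b+c)+wt(b)$; the Lee weight of a codeword is the sum of the Lee weights of its $2^\varsigma$ coefficients; and the Lee distance $d_L(\mathcal C)$ of a code $\mathcal C$ (with respect to $\mathcal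 B$) is the minimum of the Lee weights of its nonzero codewords ($0$ for the zero code). Let $0\le\omega<\alpha\le 2^\varsigma-1$ and let $\mathcal C^1_6=\langle (x+1)^\alpha,\ u^2(x+1)^\omega\rangle\subseteq\mathcal S$. Then $$d_L(\mathcal C^1_6)=\begin{cases} 2 & \text{if } 1\le\alpha\le 2^{\varsigma-1},\\ 2 & \text{if } 2^{\varsigma-1}+1\le\alpha\le 2^\varsigma-1 \text{ and } \omega=0,\\ 4 & \text{if } 2^{\varsigma-1}+1\le\alpha\le 2^\varsigma-1 \text{ and } 1\le\omega\le 2^{\varsigma-1},\\ 2^{\gamma+1} & \text{if } 2^\varsigma-2^{\varsigma-\gamma}+1\le\omega<\alpha\le 2^\varsigma-2^{\varsigma-\gamma}+2^{\varsigma-\gamma-1} \text{ for some } 1\le\gamma\le\varsigma-1. \end{cases}$$ -/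

import Mathlib

namespace LeeCyclic

open Polynomial

/-- The ring `F + uF + u²F` with `u³ = 0`, that is `F[u]/⟨u³⟩`. -/
abbrev RR (F : Type*) [Field F] : Type _ := AdjoinRoot (X ^ 3 : F[X])

/-- The element `u` of `F + uF + u²F`. -/
noncomputable def u (F : Type*) [Field F] : RR F := AdjoinRoot.root (X ^ 3 : F[X])

/-- The polynomial `x ^ n - 1` over `F + uF + u²F`, with `n = 2 ^ s`. -/
noncomputable abbrev cycPoly (F : Type*) [Field F] (s : ℕ) : (RR F)[X] := X ^ (2 ^ s) - 1

/-- The ambient ring `(F + uF + u²F)[x]/⟨x ^ n - 1⟩`, `n = 2 ^ s`, whose ideals are the cyclic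
codes of length `2 ^ s`. -/
abbrev SS (F : Type*) [Field F] (s : ℕ) : Type _ := AdjoinRoot (cycPoly F s)

theorem cycPoly_monic (F : Type*) [Field F] (s : ℕ) : (cycPoly F s).Monic := by
  have h : (X ^ (2 ^ s) - C (1 : RR F)).Monic := monic_X_pow_sub_C 1 (by positivity)
  simpa [cycPoly] using h

/-- The class of `x` in the ambient ring. -/
noncomputable def xx (F : Type*) [Field F] (s : ℕ) : SS F s := AdjoinRoot.root (cycPoly F s)

/-- The image of `u` in the ambient ring. -/
noncomputable def uu (F : Type*) [Field F] (s : ℕ) : SS F s := AdjoinRoot.of (cycPoly F s) (u F)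

/-- For `r = c₀ + u c₁ + u² c₂` with `c₀, c₁, c₂ ∈ F`, the component `cᵢ` of `r`: the `i`-th
coefficient of the representative of degree less than `3`. -/
noncomputable def coord {F : Type*} [Field F] (r : RR F) (i : ℕ) : F :=
  (AdjoinRoot.modByMonicHom (monic_X_pow (R := F) 3) r).coeff i

/-- For `v = a₀ + a₁ x + ⋯ + a_{n-1} x ^ (n-1)` with `aᵢ ∈ F + uF + u²F`, the entry `aᵢ` of the
codeword `v`: the `i`-th coefficient of the representative of degree less than `n = 2 ^ s`. -/
noncomputable def entry {F : Type*} [Field F] {s : ℕ} (v : SS F s) (i : ℕ) : RR F :=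
  (AdjoinRoot.modByMonicHom (cycPoly_monic F s) v).coeff i

/-- A basis `ζ₁, …, ζₘ` of `F` over `𝔽₂` is trace orthogonal if `Tr(ζᵢ ζⱼ)` is `1` for `i = j` and
`0` for `i ≠ j`. -/
def IsTraceOrthogonal {F : Type*} [Field F] [Algebra (ZMod 2) F] {m : ℕ}
    (B : Module.Basis (Fin m) (ZMod 2) F) : Prop :=
  ∀ i j, Algebra.trace (ZMod 2) F (B i * B j) = if i = j then 1 else 0

/-- The Lee weight on `𝔽₂`. -/
def leeWt₂ (a : ZMod 2) : ℕ := if a = 0 then 0 else 1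

/-- The Lee weight on `F` with respect to a basis of `F` over `𝔽₂`. -/
noncomputable def leeWtF {F : Type*} [Field F] [Algebra (ZMod 2) F] {m : ℕ}
    (B : Module.Basis (Fin m) (ZMod 2) F) (a : F) : ℕ := ∑ i, leeWt₂ (B.repr a i)

/-- The Lee weight on `F + uF + u²F`: the weight of `a + u b + u² c` is
`wt(a + b + c) + wt(b + c) + wt(b)`. -/
noncomputable def leeWtR {F : Type*} [Field F] [Algebra (ZMod 2) F] {m : ℕ}
    (B : Module.Basis (Fin m) (ZMod 2) F) (r : RR F) : ℕ :=
  leeWtF B (coord r 0 + coord r 1 + coord r 2) + leeWtF B (coord r 1 + coord r 2) + leeWtF B (coord r 1)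

/-- The Lee weight of a codeword of length `2 ^ s`. -/
noncomputable def leeWt {F : Type*} [Field F] [Algebra (ZMod 2) F] {m s : ℕ}
    (B : Module.Basis (Fin m) (ZMod 2) F) (v : SS F s) : ℕ :=
  ∑ i ∈ Finset.range (2 ^ s), leeWtR B (entry v i)

/-- The Lee distance of a cyclic code: the minimum of the Lee weights of its nonzero codewords.
It is `0` for the zero code, since `sInf ∅ = 0` in `ℕ`. -/
noncomputable def leeDist {F : Type*} [Field F] [Algebra (ZMod 2) F] {m s : ℕ}
    (B : Module.Basis (Fin m) (ZMod 2) F) (I : Ideal (SS F s)) : ℕ :=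
  sInf {w : ℕ | ∃ v ∈ I, v ≠ 0 ∧ leeWt B v = w}

/-- The cyclic code `⟨(x+1)^α, u²(x+1)^ω⟩` of length `2 ^ s`. -/
noncomputable def code (F : Type*) [Field F] (s α ω : ℕ) : Ideal (SS F s) :=
  Ideal.span {(xx F s + 1) ^ α, uu F s ^ 2 * (xx F s + 1) ^ ω}

end LeeCyclic

namespace LeeCyclic

open Polynomial

/-! ### Hamming weights of multiples of powers of `X + 1` in characteristic two. -/

section Support

variable {K : Type*} [Field K]

/-! Split a codeword into components `a + u b + u² c`, polynomials over `F`. In the code, `(X+1)^α`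
divides `a` and `b`, and `(X+1)^ω` divides `c`. The Lee weight is at least the sum of the Hamming
weights of `a+b+c`, `b+c` and `b`. Either one of these is a nonzero multiple of `(X+1)^α`, or the
first two are both nonzero multiples of `(X+1)^ω`; this is `le_leeWt`. Hamming weights are bounded
below by `two_pow_le_card_support`, an induction based on `(X+1)^(2^t) = X^(2^t) + 1`. The bounds
are attained by `ζᵢ (X+1)^N` or `u² ζᵢ (X+1)^N` with `N = 2^s - 2^(s-k)`: all nonzero coefficients
are a single basis element, so Lee weight counts terms. -/

theorem X_add_one_pow_two_pow (R : Type*) [CommRing R] [CharP R 2] (t : ℕ) :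
    (X + 1 : R[X]) ^ 2 ^ t = X ^ 2 ^ t + 1 := by
  have : Fact (Nat.Prime 2) := ⟨Nat.prime_two⟩
  rw [add_pow_char_pow, one_pow]

theorem cycPoly_eq_X_add_one_pow [CharP (RR K) 2] (s : ℕ) :
    cycPoly K s = (X + 1) ^ 2 ^ s := by
  rw [X_add_one_pow_two_pow, cycPoly, CharTwo.sub_eq_add]

/-- A nonzero polynomial vanishing at `1` has at least two terms. -/
theorem two_le_card_support [CharP K 2] {f : K[X]} (hf : f ≠ 0) (h : (X + 1) ∣ f) :
    2 ≤ f.support.card := by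
  by_contra! hlt
  have h1 : f.support.card = 1 := by
    have := Finset.card_pos.2 (Polynomial.nonempty_support_iff.2 hf)
    omega
  obtain ⟨k, c, hc, rfl⟩ := Polynomial.card_support_eq_one.1 h1
  obtain ⟨g, hg⟩ := h
  have := congrArg (eval 1) hg
  simp [CharTwo.add_self_eq_zero] at this
  exact hc this

theorem natDegree_X_add_one_pow (R : Type*) [CommRing R] [Nontrivial R] (N : ℕ) :
    ((X + 1 : R[X]) ^ N).natDegree = N := by
  have : (X + 1 : R[X]) = X + C 1 := by simp
  rw [this, (monic_X_add_C (1 : R)).natDegree_pow, natDegree_X_add_C, mul_one]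

/-- The degree bound keeps `h` and its shift by `t` from overlapping, so nothing cancels. -/
theorem card_support_X_pow_add_one_mul {t : ℕ} {h : K[X]} (hd : h.degree < t) :
    ((X ^ t + 1) * h).support.card = 2 * h.support.card := by
  have hc : ∀ k, ((X ^ t + 1) * h).coeff k = if t ≤ k then h.coeff (k - t) else h.coeff k := by
    intro k
    rw [add_mul, one_mul, coeff_add, coeff_X_pow_mul']
    split_ifs with hk
    · rw [coeff_eq_zero_of_degree_lt (n := k) (hd.trans_le (by exact_mod_cast hk)), add_zero]
    · rw [zero_add]
  have hlt : ∀ k ∈ h.support, k < t := fun k hk => by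
    by_contra! hk'
    exact mem_support_iff.1 hk
      (coeff_eq_zero_of_degree_lt (hd.trans_le (by exact_mod_cast hk')))
  have hs : ((X ^ t + 1) * h).support =
      h.support.disjUnion (h.support.map (addRightEmbedding t)) (by
        rw [Finset.disjoint_left]
        intro a ha hb
        obtain ⟨b, -, rfl⟩ := Finset.mem_map.1 hb
        have := hlt _ ha
        simp at this) := by
    ext k
    simp only [mem_support_iff, hc, Finset.mem_disjUnion, Finset.mem_map, addRightEmbedding_apply]
    constructor
    · intro hk
      split_ifs at hk with h1
      · exact Or.inr ⟨k - t, hk, by omega⟩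
      · exact Or.inl hk
    · rintro (hk | ⟨a, ha, rfl⟩)
      · rwa [if_neg (by have := hlt k (mem_support_iff.2 hk); omega)]
      · simpa using ha
  rw [hs, Finset.card_disjUnion, Finset.card_map, two_mul]

/-- The Hamming distance of the cyclic code `⟨(x+1)^j⟩` of length `2 ^ s` over a field of
characteristic two is at least `2 ^ (γ+1)` as soon as `2 ^ s - 2 ^ (s-γ) < j`. -/
theorem two_pow_le_card_support [CharP K 2] (γ : ℕ) : ∀ (s j : ℕ) (f : K[X]), γ ≤ s → f ≠ 0 →
    f.degree < (2 ^ s : ℕ) → 2 ^ s - 2 ^ (s - γ) < j → (X + 1) ^ j ∣ f →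
    2 ^ (γ + 1) ≤ f.support.card := by
  induction γ with
  | zero =>
    intro s j f _ hf _ hj hdvd
    exact two_le_card_support hf ((dvd_pow_self _ (by omega)).trans hdvd)
  | succ γ ih =>
    intro s j f hγ hf hdeg hj hdvd
    obtain ⟨s, rfl⟩ : ∃ t, s = t + 1 := ⟨s - 1, by omega⟩
    have he : s + 1 - (γ + 1) = s - γ := by omega
    have hle : 2 ^ (s - γ) ≤ 2 ^ s := Nat.pow_le_pow_right (by norm_num) (by omega)
    rw [he, pow_succ] at hj
    -- Now `j > 2 ^ s`, so `X ^ 2 ^ s + 1` splits off; the cofactor has degree below `2 ^ s` and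
    -- half as many terms.
    obtain ⟨i, rfl⟩ : ∃ i, j = 2 ^ s + i := ⟨j - 2 ^ s, by omega⟩
    obtain ⟨h, rfl⟩ := (pow_dvd_pow (X + 1 : K[X]) (Nat.le_add_right (2 ^ s) i)).trans hdvd
    have hne : h ≠ 0 := right_ne_zero_of_mul hf
    have hp : ((X + 1 : K[X]) ^ 2 ^ s) ≠ 0 := left_ne_zero_of_mul hf
    have hd : h.degree < (2 ^ s : ℕ) := by
      rw [← natDegree_lt_iff_degree_lt hne]
      rw [← natDegree_lt_iff_degree_lt hf, natDegree_mul hp hne, natDegree_X_add_one_pow,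
        pow_succ] at hdeg
      omega
    rw [pow_add] at hdvd
    have := ih s i h (by omega) hne hd (by omega) ((mul_dvd_mul_iff_left hp).1 hdvd)
    rw [X_add_one_pow_two_pow, card_support_X_pow_add_one_mul hd, pow_succ]
    omega

/-- The polynomial `(X+1) ^ (2 ^ s - 2 ^ (s-k))` has at most `2 ^ k` terms. -/
theorem card_support_X_add_one_pow_le [CharP K 2] (s k : ℕ) (hk : k ≤ s) :
    ((X + 1 : K[X]) ^ (2 ^ s - 2 ^ (s - k))).support.card ≤ 2 ^ k := by
  induction k with
  | zero =>
    simpa using (card_support_le_one_iff_monomial (f := (1 : K[X]))).2 ⟨0, 1, by simp⟩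
  | succ k ih =>
    have h1 : 2 ^ (s - k) = 2 * 2 ^ (s - (k + 1)) := by
      rw [← pow_succ']
      congr 1
      omega
    have h2 : 2 ^ (s - k) ≤ 2 ^ s := Nat.pow_le_pow_right (by norm_num) (by omega)
    -- Raising `k` by one multiplies the polynomial by the binomial `X ^ 2 ^ (s - (k + 1)) + 1`.
    have h3 : 2 ^ s - 2 ^ (s - (k + 1)) = 2 ^ (s - k) - 2 ^ (s - (k + 1)) + (2 ^ s - 2 ^ (s - k)) := by
      omega
    have h4 : 2 ^ (s - k) - 2 ^ (s - (k + 1)) = 2 ^ (s - (k + 1)) := by omega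
    have := ih (by omega)
    rw [h3, h4, pow_add, X_add_one_pow_two_pow, add_mul, one_mul, pow_succ]
    refine (Finset.card_le_card support_add).trans ((Finset.card_union_le _ _).trans ?_)
    have h5 := card_support_mul_le (p := (X : K[X]) ^ 2 ^ (s - (k + 1)))
      (q := (X + 1) ^ (2 ^ s - 2 ^ (s - k)))
    rw [support_X_pow, Finset.card_singleton, one_mul] at h5
    omega

end Support

/-! ### Components over `F` of ring elements, polynomials and codewords. -/

section Coordinates

variable {F : Type*} [Field F]

theorem coord_add (a b : RR F) (i : ℕ) : coord (a + b) i = coord a i + coord b i := by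
  simp [coord]

theorem coord_zero (i : ℕ) : coord (0 : RR F) i = 0 := by
  simp [coord]

theorem coord_sum {ι : Type*} (t : Finset ι) (f : ι → RR F) (i : ℕ) :
    coord (∑ k ∈ t, f k) i = ∑ k ∈ t, coord (f k) i := by
  simp [coord]

theorem coord_mk (p : F[X]) (i : ℕ) :
    coord (AdjoinRoot.mk (X ^ 3 : F[X]) p) i = if i < 3 then p.coeff i else 0 := by
  rw [coord, AdjoinRoot.modByMonicHom_mk]
  split_ifs with hi
  · conv_rhs => rw [← modByMonic_add_div p (X ^ 3 : F[X])]
    rw [coeff_add, coeff_X_pow_mul', if_neg (by omega), add_zero]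
  · exact coeff_eq_zero_of_degree_lt ((degree_modByMonic_lt _ (monic_X_pow 3)).trans_le (by
      rw [degree_X_pow]
      exact_mod_cast not_lt.1 hi))

theorem coord_mul_algebraMap (r : RR F) (c : F) (i : ℕ) :
    coord (r * algebraMap F (RR F) c) i = coord r i * c := by
  rw [mul_comm, ← Algebra.smul_def]
  simp [coord, mul_comm]

theorem coord_mul_u_sq (r : RR F) {i : ℕ} (hi : i < 2) : coord (r * u F ^ 2) i = 0 := by
  obtain ⟨p, rfl⟩ := AdjoinRoot.mk_surjective r
  rw [u, ← AdjoinRoot.mk_X, ← map_pow, ← map_mul, coord_mk, coeff_mul_X_pow']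
  split_ifs <;> first | rfl | omega

theorem coord_algebraMap (c : F) (i : ℕ) :
    coord (algebraMap F (RR F) c) i = if i = 0 then c else 0 := by
  rw [AdjoinRoot.algebraMap_eq, ← AdjoinRoot.mk_C, coord_mk, coeff_C]
  split_ifs <;> first | rfl | omega

theorem coord_u_sq_mul_algebraMap (c : F) (i : ℕ) :
    coord (u F ^ 2 * algebraMap F (RR F) c) i = if i = 2 then c else 0 := by
  rw [coord_mul_algebraMap, u, ← AdjoinRoot.mk_X, ← map_pow, coord_mk, coeff_X_pow]
  split_ifs <;> first | omega | simp

theorem eq_zero_of_coord {r : RR F} (h0 : coord r 0 = 0) (h1 : coord r 1 = 0)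
    (h2 : coord r 2 = 0) : r = 0 := by
  obtain ⟨p, rfl⟩ := AdjoinRoot.mk_surjective r
  rw [coord_mk] at h0 h1 h2
  rw [AdjoinRoot.mk_eq_zero, X_pow_dvd_iff]
  intro d hd
  interval_cases d <;> simpa using ‹_›

/-- The polynomial over `F` whose coefficients are the `i`-th components of those of `f`. -/
noncomputable def coordPoly (i : ℕ) (f : (RR F)[X]) : F[X] :=
  ∑ k ∈ f.support, monomial k (coord (f.coeff k) i)

theorem coeff_coordPoly (i : ℕ) (f : (RR F)[X]) (k : ℕ) :
    (coordPoly i f).coeff k = coord (f.coeff k) i := by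
  rw [coordPoly, finsetSum_coeff]
  simp only [coeff_monomial, Finset.sum_ite_eq', mem_support_iff]
  split_ifs with h
  · rfl
  · rw [not_not.1 h, coord_zero]

theorem coordPoly_add (i : ℕ) (f g : (RR F)[X]) :
    coordPoly i (f + g) = coordPoly i f + coordPoly i g := by
  ext k
  simp [coeff_coordPoly, coord_add]

/-- Taking components is `F`-linear; hence divisibility by powers of `X + 1` passes to them. -/
theorem coordPoly_mul_map (i : ℕ) (f : (RR F)[X]) (g : F[X]) :
    coordPoly i (f * g.map (algebraMap F (RR F))) = coordPoly i f * g := by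
  ext k
  simp only [coeff_coordPoly, coeff_mul, coord_sum, coeff_map, coord_mul_algebraMap]

theorem coordPoly_mul_X_add_one_pow (i : ℕ) (f : (RR F)[X]) (j : ℕ) :
    coordPoly i (f * (X + 1) ^ j) = coordPoly i f * (X + 1) ^ j := by
  rw [← coordPoly_mul_map]
  simp

theorem coordPoly_mul_u_sq (f : (RR F)[X]) {i : ℕ} (hi : i < 2) :
    coordPoly i (f * C (u F ^ 2)) = 0 := by
  ext k
  rw [coeff_coordPoly, coeff_mul_C, coord_mul_u_sq _ hi, coeff_zero]

theorem degree_coordPoly_lt (i : ℕ) {f : (RR F)[X]} {n : ℕ} (h : f.degree < n) :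
    (coordPoly i f).degree < n := by
  rw [degree_lt_iff_coeff_zero] at h ⊢
  intro k hk
  rw [coeff_coordPoly, h k hk, coord_zero]

theorem coordPoly_map (i : ℕ) (g : F[X]) :
    coordPoly i (g.map (algebraMap F (RR F))) = if i = 0 then g else 0 := by
  ext k
  rw [coeff_coordPoly, coeff_map, coord_algebraMap]
  split_ifs <;> simp

theorem coordPoly_u_sq_map (i : ℕ) (g : F[X]) :
    coordPoly i (C (u F ^ 2) * g.map (algebraMap F (RR F))) = if i = 2 then g else 0 := by
  ext k
  rw [coeff_coordPoly, coeff_C_mul, coeff_map, coord_u_sq_mul_algebraMap]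
  split_ifs <;> simp

instance : Nontrivial (RR F) := AdjoinRoot.nontrivial _ (by simp)

theorem charP_RR [CharP F 2] : CharP (RR F) 2 :=
  charP_of_injective_algebraMap (algebraMap F (RR F)).injective 2

/-- The representative of degree less than `2 ^ s` of a codeword. -/
noncomputable def repPoly {s : ℕ} (v : SS F s) : (RR F)[X] :=
  AdjoinRoot.modByMonicHom (cycPoly_monic F s) v

theorem degree_repPoly_lt {s : ℕ} (v : SS F s) : (repPoly v).degree < (2 ^ s : ℕ) := by
  obtain ⟨p, rfl⟩ := AdjoinRoot.mk_surjective v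
  rw [repPoly, AdjoinRoot.modByMonicHom_mk]
  refine (degree_modByMonic_lt _ (cycPoly_monic F s)).trans_le (degree_le_of_natDegree_le ?_)
  have : cycPoly F s = X ^ 2 ^ s - C 1 := by simp [cycPoly]
  rw [this, natDegree_X_pow_sub_C]

theorem mk_repPoly {s : ℕ} (v : SS F s) : AdjoinRoot.mk (cycPoly F s) (repPoly v) = v :=
  AdjoinRoot.mk_leftInverse (cycPoly_monic F s) v

theorem repPoly_mk_of_degree_lt {s : ℕ} {p : (RR F)[X]} (hp : p.degree < (2 ^ s : ℕ)) :
    repPoly (AdjoinRoot.mk (cycPoly F s) p) = p := by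
  rw [repPoly, AdjoinRoot.modByMonicHom_mk, modByMonic_eq_self_iff (cycPoly_monic F s)]
  have : cycPoly F s = X ^ 2 ^ s - C 1 := by simp [cycPoly]
  rwa [this, degree_X_pow_sub_C (by positivity)]

/-- The modulus is `(X+1) ^ 2 ^ s`, a multiple of `(X+1) ^ α`, so reduction only changes the
cofactor `a`. -/
theorem exists_repPoly_eq [CharP F 2] {s α ω : ℕ} (hα : α ≤ 2 ^ s) {v : SS F s}
    (hv : v ∈ code F s α ω) :
    ∃ a b : (RR F)[X],
      repPoly v = a * (X + 1) ^ α + b * C (u F ^ 2) * (X + 1) ^ ω := by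
  have := charP_RR (F := F)
  obtain ⟨a, b, rfl⟩ := Ideal.mem_span_pair.1 hv
  obtain ⟨a, rfl⟩ := AdjoinRoot.mk_surjective a
  obtain ⟨b, rfl⟩ := AdjoinRoot.mk_surjective b
  set v := AdjoinRoot.mk (cycPoly F s) a * (xx F s + 1) ^ α +
    AdjoinRoot.mk (cycPoly F s) b * (uu F s ^ 2 * (xx F s + 1) ^ ω) with hvdef
  have h : AdjoinRoot.mk (cycPoly F s) (a * (X + 1) ^ α + b * C (u F ^ 2) * (X + 1) ^ ω) = v := by
    simp [hvdef, xx, uu, mul_assoc]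
  rw [← mk_repPoly v, eq_comm, AdjoinRoot.mk_eq_mk, cycPoly_eq_X_add_one_pow] at h
  obtain ⟨q, hq⟩ := h
  refine ⟨a + q * (X + 1) ^ (2 ^ s - α), b, ?_⟩
  rw [sub_eq_iff_eq_add.1 hq, add_mul a, mul_assoc q, ← pow_add, Nat.sub_add_cancel hα]
  ring

theorem dvd_coordPoly_of_mem_code [CharP F 2] {s α ω : ℕ} (hα : α ≤ 2 ^ s) {v : SS F s}
    (hv : v ∈ code F s α ω) {i : ℕ} (hi : i < 2) :
    (X + 1) ^ α ∣ coordPoly i (repPoly v) := by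
  obtain ⟨a, b, h⟩ := exists_repPoly_eq hα hv
  rw [h, coordPoly_add, coordPoly_mul_X_add_one_pow, coordPoly_mul_X_add_one_pow,
    coordPoly_mul_u_sq _ hi, zero_mul, add_zero]
  exact dvd_mul_left _ _

theorem dvd_coordPoly_two_of_mem_code [CharP F 2] {s α ω : ℕ} (hα : α ≤ 2 ^ s) (hω : ω ≤ α)
    {v : SS F s} (hv : v ∈ code F s α ω) :
    (X + 1) ^ ω ∣ coordPoly 2 (repPoly v) := by
  obtain ⟨a, b, h⟩ := exists_repPoly_eq hα hv
  rw [h, coordPoly_add, coordPoly_mul_X_add_one_pow, coordPoly_mul_X_add_one_pow]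
  exact dvd_add ((pow_dvd_pow _ hω).trans (dvd_mul_left _ _)) (dvd_mul_left _ _)

theorem eq_zero_of_coordPoly {s : ℕ} {v : SS F s} (h0 : coordPoly 0 (repPoly v) = 0)
    (h1 : coordPoly 1 (repPoly v) = 0) (h2 : coordPoly 2 (repPoly v) = 0) : v = 0 := by
  rw [← mk_repPoly v]
  suffices repPoly v = 0 by rw [this, map_zero]
  ext k
  rw [coeff_zero]
  apply eq_zero_of_coord
  · rw [← coeff_coordPoly, h0, coeff_zero]
  · rw [← coeff_coordPoly, h1, coeff_zero]
  · rw [← coeff_coordPoly, h2, coeff_zero]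

end Coordinates

/-! ### Lee weights: the lower bound and the codewords attaining it. -/

section Weight

variable {F : Type*} [Field F] [Algebra (ZMod 2) F] {m : ℕ} (B : Module.Basis (Fin m) (ZMod 2) F)

theorem leeWtF_zero : leeWtF B 0 = 0 := by
  simp [leeWtF, leeWt₂]

theorem one_le_leeWtF {a : F} (ha : a ≠ 0) : 1 ≤ leeWtF B a := by
  obtain ⟨i, hi⟩ : ∃ i, B.repr a i ≠ 0 := by
    by_contra! h
    exact ha (B.repr.map_eq_zero_iff.1 (Finsupp.ext h))
  have : leeWt₂ (B.repr a i) ≤ leeWtF B a :=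
    Finset.single_le_sum (f := fun i => leeWt₂ (B.repr a i)) (fun _ _ => Nat.zero_le _)
      (Finset.mem_univ i)
  simpa [leeWt₂, hi] using this

theorem leeWtF_smul_basis (e : ZMod 2) (i : Fin m) : leeWtF B (e • B i) = leeWt₂ e := by
  classical
  rw [leeWtF, Finset.sum_eq_single i]
  · simp
  · intro j _ hj
    simp [leeWt₂, hj.symm]
  · simp

/-- The Lee weight of the first `n` coefficients of a polynomial over `F`. -/
noncomputable def leeWtPoly (n : ℕ) (f : F[X]) : ℕ := ∑ k ∈ Finset.range n, leeWtF B (f.coeff k)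

theorem card_support_le_leeWtPoly {n : ℕ} {f : F[X]} (hf : f.degree < n) :
    f.support.card ≤ leeWtPoly B n f := by
  have hsub : f.support ⊆ Finset.range n := fun k hk => by
    rw [Finset.mem_range]
    by_contra! h
    exact mem_support_iff.1 hk (coeff_eq_zero_of_degree_lt (hf.trans_le (by exact_mod_cast h)))
  rw [Finset.card_eq_sum_ones]
  exact (Finset.sum_le_sum fun k hk => one_le_leeWtF B (mem_support_iff.1 hk)).trans
    (Finset.sum_le_sum_of_subset hsub)

theorem leeWtPoly_basis_mul_le (n : ℕ) (g : (ZMod 2)[X]) (i : Fin m) :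
    leeWtPoly B n (C (B i) * g.map (algebraMap (ZMod 2) F)) ≤ g.support.card := by
  have h : ∀ k, leeWtF B ((C (B i) * g.map (algebraMap (ZMod 2) F)).coeff k) =
      if k ∈ g.support then 1 else 0 := fun k => by
    rw [coeff_C_mul, coeff_map, mul_comm, ← Algebra.smul_def, leeWtF_smul_basis, leeWt₂]
    simp only [mem_support_iff, ite_not]
  rw [leeWtPoly, Finset.sum_congr rfl fun k _ => h k, Finset.sum_ite_mem, Finset.sum_const,
    smul_eq_mul, mul_one]
  exact Finset.card_le_card Finset.inter_subset_right

theorem leeWt_eq {s : ℕ} (v : SS F s) :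
    leeWt B v =
      leeWtPoly B (2 ^ s) (coordPoly 0 (repPoly v) + coordPoly 1 (repPoly v) +
        coordPoly 2 (repPoly v)) +
      leeWtPoly B (2 ^ s) (coordPoly 1 (repPoly v) + coordPoly 2 (repPoly v)) +
      leeWtPoly B (2 ^ s) (coordPoly 1 (repPoly v)) := by
  simp only [leeWt, leeWtR, leeWtPoly, coeff_add, coeff_coordPoly, Finset.sum_add_distrib]
  rfl

/-- The Lee distance of `⟨(x+1)^α, u²(x+1)^ω⟩` is at least the minimum of the Hamming distance of
`⟨(x+1)^α⟩` and twice that of `⟨(x+1)^ω⟩`. -/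
theorem le_leeWt [CharP F 2] {s α ω d : ℕ} (hα : α ≤ 2 ^ s) (hω : ω ≤ α)
    (hdα : ∀ f : F[X], f ≠ 0 → f.degree < (2 ^ s : ℕ) → (X + 1) ^ α ∣ f → d ≤ f.support.card)
    (hdω : ∀ f : F[X], f ≠ 0 → f.degree < (2 ^ s : ℕ) → (X + 1) ^ ω ∣ f →
      d ≤ 2 * f.support.card)
    {v : SS F s} (hv : v ∈ code F s α ω) (hv0 : v ≠ 0) : d ≤ leeWt B v := by
  rw [leeWt_eq]
  have hdeg := degree_repPoly_lt v
  have d0 := degree_coordPoly_lt 0 hdeg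
  have d1 := degree_coordPoly_lt 1 hdeg
  have d2 := degree_coordPoly_lt 2 hdeg
  have h0 := dvd_coordPoly_of_mem_code hα hv (i := 0) (by norm_num)
  have h1 := dvd_coordPoly_of_mem_code hα hv (i := 1) (by norm_num)
  have h2 := dvd_coordPoly_two_of_mem_code hα hω hv
  have hz := mt (fun h : _ ∧ _ ∧ _ => eq_zero_of_coordPoly (v := v) h.1 h.2.1 h.2.2) hv0
  generalize coordPoly 0 (repPoly v) = a at *
  generalize coordPoly 1 (repPoly v) = b at *
  generalize coordPoly 2 (repPoly v) = c at *
  have lift : ∀ j, j ≤ α → (X + 1 : F[X]) ^ j ∣ (X + 1) ^ α := fun j hj => pow_dvd_pow _ hj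
  have dbc : (b + c).degree < (2 ^ s : ℕ) := (degree_add_le _ _).trans_lt (max_lt d1 d2)
  have dabc : (a + b + c).degree < (2 ^ s : ℕ) := by
    rw [add_assoc]
    exact (degree_add_le _ _).trans_lt (max_lt d0 dbc)
  have wb := card_support_le_leeWtPoly B d1
  have wbc := card_support_le_leeWtPoly B dbc
  have wabc := card_support_le_leeWtPoly B dabc
  have ωbc : (X + 1 : F[X]) ^ ω ∣ b + c := dvd_add ((lift ω hω).trans h1) h2
  have ωabc : (X + 1 : F[X]) ^ ω ∣ a + b + c := by
    rw [add_assoc]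
    exact dvd_add ((lift ω hω).trans h0) ωbc
  by_cases hbc : b + c = 0
  · by_cases ha : a = 0
    · by_cases hb : b = 0
      · exact absurd ⟨ha, hb, by simpa [hb] using hbc⟩ hz
      · have := hdα b hb d1 h1
        omega
    · have : a + b + c = a := by rw [add_assoc, hbc, add_zero]
      have := hdα (a + b + c) (by rwa [this]) dabc (by rwa [this])
      omega
  · by_cases habc : a + b + c = 0
    -- Here `b + c` inherits the stronger divisibility of `a`.
    · have : b + c = -a := by linear_combination habc
      have := hdα (b + c) hbc dbc (by rw [this]; exact (dvd_neg).2 h0)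
      omega
    · have e1 := hdω _ hbc dbc ωbc
      have e2 := hdω _ habc dabc ωabc
      omega

theorem leeDist_eq {s d : ℕ} {I : Ideal (SS F s)} (h : ∀ v ∈ I, v ≠ 0 → d ≤ leeWt B v)
    (h' : ∃ v ∈ I, v ≠ 0 ∧ leeWt B v ≤ d) : leeDist B I = d := by
  obtain ⟨v, hv, hv0, hle⟩ := h'
  have hmem : leeWt B v ∈ {w : ℕ | ∃ v ∈ I, v ≠ 0 ∧ leeWt B v = w} := ⟨v, hv, hv0, rfl⟩
  refine le_antisymm ((Nat.sInf_le hmem).trans hle) (le_csInf ⟨_, hmem⟩ ?_)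
  rintro _ ⟨w, hw, hw0, rfl⟩
  exact h w hw hw0

theorem leeWtPoly_zero (n : ℕ) : leeWtPoly B n 0 = 0 := by
  simp [leeWtPoly, leeWtF_zero]

/-- The polynomial `ζᵢ (X+1)^N` over `F`. -/
noncomputable def basisPoly (i : Fin m) (N : ℕ) : F[X] :=
  C (B i) * ((X + 1 : (ZMod 2)[X]) ^ N).map (algebraMap (ZMod 2) F)

theorem basisPoly_eq (i : Fin m) (N : ℕ) : basisPoly B i N = C (B i) * (X + 1) ^ N := by
  simp [basisPoly]

theorem basisPoly_ne_zero (i : Fin m) (N : ℕ) : basisPoly B i N ≠ 0 := by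
  rw [basisPoly_eq]
  exact mul_ne_zero (C_ne_zero.2 (B.ne_zero i))
    (pow_ne_zero _ (by simpa using X_add_C_ne_zero (1 : F)))

theorem degree_basisPoly_lt (i : Fin m) {N n : ℕ} (h : N < n) : (basisPoly B i N).degree < n := by
  rw [← natDegree_lt_iff_degree_lt (basisPoly_ne_zero B i N), basisPoly_eq,
    natDegree_C_mul (B.ne_zero i), natDegree_X_add_one_pow]
  exact h

theorem map_basisPoly (i : Fin m) {N j : ℕ} (h : j ≤ N) :
    (basisPoly B i N).map (algebraMap F (RR F)) =
      C (algebraMap F (RR F) (B i)) * (X + 1) ^ (N - j) * (X + 1) ^ j := by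
  rw [basisPoly_eq, mul_assoc, ← pow_add, Nat.sub_add_cancel h]
  simp

theorem two_pow_sub_lt (s k : ℕ) : 2 ^ s - 2 ^ (s - k) < 2 ^ s :=
  Nat.sub_lt (by positivity) (by positivity)

/-- The components are `(g, 0, 0)`, so `g` is counted once. -/
theorem exists_mem_code_leeWt_le (i : Fin m) {s α ω k : ℕ} (hk : k ≤ s)
    (hα : α ≤ 2 ^ s - 2 ^ (s - k)) : ∃ v ∈ code F s α ω, v ≠ 0 ∧ leeWt B v ≤ 2 ^ k := by
  set g := basisPoly B i (2 ^ s - 2 ^ (s - k)) with hg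
  have hd : g.degree < (2 ^ s : ℕ) := degree_basisPoly_lt B i (two_pow_sub_lt s k)
  have hr := repPoly_mk_of_degree_lt (s := s)
    ((degree_map_le (f := algebraMap F (RR F)) (p := g)).trans_lt hd)
  refine ⟨AdjoinRoot.mk (cycPoly F s) (g.map (algebraMap F (RR F))), ?_, ?_, ?_⟩
  · rw [hg, map_basisPoly B i hα, map_mul]
    refine Ideal.mul_mem_left _ _ (Ideal.subset_span (Or.inl ?_))
    simp [xx]
  · intro h0
    have := coordPoly_map 0 g
    rw [← hr, h0] at this
    exact basisPoly_ne_zero B i _ (by simpa [repPoly, coordPoly] using this.symm)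
  · rw [leeWt_eq, hr, coordPoly_map, coordPoly_map, coordPoly_map]
    simp only [if_true, one_ne_zero, two_ne_zero, if_false, add_zero, leeWtPoly_zero]
    exact (leeWtPoly_basis_mul_le B _ _ i).trans (card_support_X_add_one_pow_le s k hk)

/-- The components are `(0, 0, g)`, so `g` is counted twice, in `a + b + c` and in `b + c`. -/
theorem exists_mem_code_leeWt_le_two_mul (i : Fin m) {s α ω k : ℕ} (hk : k ≤ s)
    (hω : ω ≤ 2 ^ s - 2 ^ (s - k)) : ∃ v ∈ code F s α ω, v ≠ 0 ∧ leeWt B v ≤ 2 ^ (k + 1) := by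
  set g := basisPoly B i (2 ^ s - 2 ^ (s - k)) with hg
  have hd : g.degree < (2 ^ s : ℕ) := degree_basisPoly_lt B i (two_pow_sub_lt s k)
  have hr := repPoly_mk_of_degree_lt (s := s)
    (p := C (u F ^ 2) * g.map (algebraMap F (RR F)))
    ((smul_eq_C_mul (u F ^ 2) ▸ degree_smul_le (u F ^ 2) _).trans_lt
      ((degree_map_le (f := algebraMap F (RR F)) (p := g)).trans_lt hd))
  refine ⟨AdjoinRoot.mk (cycPoly F s) (C (u F ^ 2) * g.map (algebraMap F (RR F))), ?_, ?_, ?_⟩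
  · rw [hg, map_basisPoly B i hω, mul_left_comm, map_mul]
    refine Ideal.mul_mem_left _ _ (Ideal.subset_span (Or.inr ?_))
    simp [xx, uu]
  · intro h0
    have := coordPoly_u_sq_map 2 g
    rw [← hr, h0] at this
    exact basisPoly_ne_zero B i _ (by simpa [repPoly, coordPoly] using this.symm)
  · rw [leeWt_eq, hr, coordPoly_u_sq_map, coordPoly_u_sq_map, coordPoly_u_sq_map]
    have := (leeWtPoly_basis_mul_le B (2 ^ s) _ i).trans
      (card_support_X_add_one_pow_le (K := ZMod 2) s k hk)
    change leeWtPoly B (2 ^ s) g ≤ 2 ^ k at this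
    norm_num [leeWtPoly_zero, pow_succ]
    omega

end Weight

end LeeCyclic

/-! ### The four cases of the distance formula. -/

open LeeCyclic Polynomial in
theorem mainTheorem10 {F : Type*} [Field F] [Algebra (ZMod 2) F] (m : ℕ) (hm : 1 ≤ m)
    (hF : Nat.card F = 2 ^ m) (B : Module.Basis (Fin m) (ZMod 2) F)
    (hB : LeeCyclic.IsTraceOrthogonal B) (s : ℕ) (hs : 1 ≤ s) (α ω : ℕ)
    (hωα : ω < α) (hα : α ≤ 2 ^ s - 1) :
    (1 ≤ α → α ≤ 2 ^ (s - 1) → LeeCyclic.leeDist B (LeeCyclic.code F s α ω) = 2) ∧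
    (2 ^ (s - 1) + 1 ≤ α → ω = 0 → LeeCyclic.leeDist B (LeeCyclic.code F s α ω) = 2) ∧
    (2 ^ (s - 1) + 1 ≤ α → 1 ≤ ω → ω ≤ 2 ^ (s - 1) →
      LeeCyclic.leeDist B (LeeCyclic.code F s α ω) = 4) ∧
    (∀ γ : ℕ, 1 ≤ γ → γ ≤ s - 1 → 2 ^ s - 2 ^ (s - γ) + 1 ≤ ω →
      α ≤ 2 ^ s - 2 ^ (s - γ) + 2 ^ (s - γ - 1) →
      LeeCyclic.leeDist B (LeeCyclic.code F s α ω) = 2 ^ (γ + 1)) := by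
  have hchar : CharP F 2 := charP_of_injective_algebraMap (algebraMap (ZMod 2) F).injective 2
  let i : Fin m := ⟨0, hm⟩
  have hα' : α ≤ 2 ^ s := hα.trans (Nat.sub_le _ _)
  have hhalf : 2 ^ s = 2 * 2 ^ (s - 1) := by
    rw [← pow_succ', Nat.sub_add_cancel hs]
  have hpos : ∀ f : F[X], f ≠ 0 → 1 ≤ f.support.card := fun f hf =>
    Finset.card_pos.2 (nonempty_support_iff.2 hf)
  have hmin : ∀ γ j, γ ≤ s → 2 ^ s - 2 ^ (s - γ) < j → ∀ f : F[X], f ≠ 0 →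
      f.degree < (2 ^ s : ℕ) → (X + 1) ^ j ∣ f → 2 ^ (γ + 1) ≤ f.support.card :=
    fun γ j hγ hj f hf hd hdvd => two_pow_le_card_support γ s j f hγ hf hd hj hdvd
  refine ⟨fun h1 h2 => ?_, fun h1 h2 => ?_, fun h1 h2 h3 => ?_, fun γ h1 h2 h3 h4 => ?_⟩
  · refine leeDist_eq B (fun v hv hv0 => le_leeWt B hα' hωα.le
      (hmin 0 α (by omega) (by simpa [Nat.pos_iff_ne_zero, Nat.one_le_iff_ne_zero] using h1)) (fun f hf _ _ => ?_) hv hv0)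
      (exists_mem_code_leeWt_le B i (k := 1) hs (by omega))
    have := hpos f hf
    omega
  · refine leeDist_eq B (fun v hv hv0 => le_leeWt B hα' hωα.le
      (hmin 0 α (by omega) (by simp; omega)) (fun f hf _ _ => ?_) hv hv0)
      (exists_mem_code_leeWt_le_two_mul B i (k := 0) (by omega) (by omega))
    have := hpos f hf
    omega
  · refine leeDist_eq B (fun v hv hv0 => le_leeWt B hα' hωα.le
      (hmin 1 α hs (by omega)) (fun f hf hd hdvd => ?_) hv hv0)
      (exists_mem_code_leeWt_le_two_mul B i (k := 1) hs (by omega))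
    have := hmin 0 ω (by omega) (by simpa [Nat.pos_iff_ne_zero, Nat.one_le_iff_ne_zero] using h2) f hf hd hdvd
    omega
  · have e1 : 2 ^ (s - γ) = 2 * 2 ^ (s - γ - 1) := by
      rw [← pow_succ', Nat.sub_add_cancel (by omega)]
    have e2 : 2 ^ (s - γ) ≤ 2 ^ s := Nat.pow_le_pow_right (by norm_num) (by omega)
    have e3 : s - (γ + 1) = s - γ - 1 := by omega
    -- The upper limit on `α` equals `2^s - 2^(s-(γ+1))`, so `k = γ + 1` gives a word of weight at
    -- most `2^(γ+1)`.
    refine leeDist_eq B (fun v hv hv0 => le_leeWt B hα' hωα.le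
      (hmin γ α (by omega) (by omega)) (fun f hf hd hdvd => ?_) hv hv0)
      (exists_mem_code_leeWt_le B i (k := γ + 1) (by omega) (by rw [e3]; omega))
    have := hmin γ ω (by omega) (by omega) f hf hd hdvd
    omega
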